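/- For $n\ge 1$ let $\mathcal A_{A_n}$ be the Artin group of type $A_n$ (the braid group on $n+1$ strings), i.e. the group with generators $a_1,\dots,a_n$ and defining relations $a_ia_j=a_ja_i$ for $|i-j|\ge 2$ and $a_ia_{i+1}a_i=a_{i+1}a_ia_{i+1}$ for $1\le i\le n-1$. Let $\mathcal A_{A_n}'$ be its commutator subgroup. Put $$p_0=a_2a_1^{-1},\qquad p_1=a_1a_2a_1^{-2},\qquad q_\ell=a_\ell a_1^{-1}\ (3\le \ell\le n),\qquad b=a_2a_1^{-1}a_3a_2^{-1}\ (n\ge 3).$$ **Theorem.** For every $n\ge 2$ the group $\mathcal A_{A_n}'$ is finitely presented. More precisely: 1. $\mathcal A_{A_2}'$ is a free group with free basis $p_0,p_1$. 2. $\mathcal A_{A_3}'$ is the group generated by $p_0,\ p_1,\ q=q_3=a_3a_1^{-1},\ b$ with defining relations $$b=p_0qp_0^{-1},\quad p_0bp_0^{-1}=b^2q^{-1}b,\quad p_1qp_1^{-1}=q^{-1}b,\quad p_1bp_1^{-1}=(q^{-1}b)^3q^{-2}b.$$ 3. For $n\ge 4$ the group $\mathcal A_{A_n}'$ is generated by $p_0,\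 p_1,\ b$ and $q_\ell$ $(3\le \ell\le n)$ with defining relations $$b=p_0q_3p_0^{-1},\quad p_0bp_0^{-1}=b^2q_3^{-1}b,\quad p_1q_3p_1^{-1}=q_3^{-1}b,\quad p_1bp_1^{-1}=(q_3^{-1}b)^3q_3^{-2}b,$$ $$p_0q_i=q_ip_1\ (4\le i\le n),\qquad p_1q_i=q_ip_0^{-1}p_1\ (4\le i\le n),$$ $$q_3q_i=q_iq_3\ (5\le i\le n),\qquad q_3q_4q_3=q_4q_3q_4,$$ $$q_iq_j=q_jq_i\ (4\le i<j-1\le n-1),\qquad q_iq_{i+1}q_i=q_{i+1}q_iq_{i+1}\ (4\le i\le n-1).$$ -/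

import Mathlib

/-- The alternating product `⟨a b⟩^m = a * b * a * ⋯` with `m` factors, starting with `a`. -/
def altProd {G : Type*} [Group G] (a b : G) : ℕ → G
  | 0 => 1
  | m + 1 => a * altProd b a m

/-- The relators of the Artin group of a Coxeter matrix `M`: one relation
`⟨a b⟩^(m_ab) = ⟨b a⟩^(m_ab)` for each pair of generators. An infinite entry is encoded in
`CoxeterMatrix` by `0` and gives the trivial relation `1 = 1`; the diagonal entries `1` give
the trivial relation `a = a`. -/
def artinRels {B : Type*} (M : CoxeterMatrix B) : Set (FreeGroup B) :=
  {r | ∃ i j : B, r = altProd (FreeGroup.of i) (FreeGroup.of j) (M i j) *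
    (altProd (FreeGroup.of j) (FreeGroup.of i) (M i j))⁻¹}

/-- The Artin group of a Coxeter matrix. -/
abbrev ArtinGroup {B : Type*} (M : CoxeterMatrix B) : Type _ :=
  PresentedGroup (artinRels M)

/-- The Artin group of type `A_n`, that is, the braid group on `n + 1` strings. -/
abbrev ArtinA (n : ℕ) : Type :=
  ArtinGroup (CoxeterMatrix.A n)

namespace ArtinA

/-- The standard generator `a_i` of the Artin group of type `A_n`, for `1 ≤ i ≤ n`. -/
def a {n : ℕ} (i : ℕ) (h : 1 ≤ i ∧ i ≤ n) : ArtinA n :=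
  PresentedGroup.of (⟨i - 1, by omega⟩ : Fin n)

/-- `p_0 = a_2 a_1⁻¹`. -/
def p0 {n : ℕ} (hn : 2 ≤ n) : ArtinA n :=
  a 2 (by omega) * (a 1 (by omega))⁻¹

/-- `p_1 = a_1 a_2 a_1⁻²`. -/
def p1 {n : ℕ} (hn : 2 ≤ n) : ArtinA n :=
  a 1 (by omega) * a 2 (by omega) * (a 1 (by omega) ^ 2)⁻¹

/-- `q_l = a_l a_1⁻¹`, for `3 ≤ l ≤ n`. -/
def q {n : ℕ} (l : ℕ) (h : 3 ≤ l ∧ l ≤ n) : ArtinA n :=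
  a l (by omega) * (a 1 (by omega))⁻¹

/-- `b = a_2 a_1⁻¹ a_3 a_2⁻¹`. -/
def b {n : ℕ} (hn : 3 ≤ n) : ArtinA n :=
  a 2 (by omega) * (a 1 (by omega))⁻¹ * a 3 (by omega) * (a 2 (by omega))⁻¹

end ArtinA

/-- The set of relators `u * v⁻¹` attached to a set of relations `u = v`. -/
def relatorSet {ι : Type*} (R : FreeGroup ι → FreeGroup ι → Prop) : Set (FreeGroup ι) :=
  {r | ∃ u v, R u v ∧ r = u * v⁻¹}

/-- The subgroup `H` of `G` is the group generated by the elements `f i` of `G` with defining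
relations `R`: the homomorphism from the free group that sends the letter `i` to `f i` has
image `H`, and its kernel is the normal closure of the relators of `R`. -/
def HasPresentation {G ι : Type*} [Group G] (H : Subgroup G) (f : ι → G)
    (R : FreeGroup ι → FreeGroup ι → Prop) : Prop :=
  (FreeGroup.lift f).range = H ∧
    (FreeGroup.lift f).ker = Subgroup.normalClosure (relatorSet R)

/-- The letters of the presentation in the case `n = 3`. -/
inductive GenA3 : Type
  | p0 | p1 | q | b

namespace GenA3

/-- The elements of the Artin group of type `A_3` denoted by the letters. -/
def val : GenA3 → ArtinA 3
  | p0 => ArtinA.p0 (by omega)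
  | p1 => ArtinA.p1 (by omega)
  | q => ArtinA.q 3 (by omega)
  | b => ArtinA.b (by omega)

/- The letters as elements of the free group. -/
abbrev P0 : FreeGroup GenA3 := FreeGroup.of p0
abbrev P1 : FreeGroup GenA3 := FreeGroup.of p1
abbrev Q : FreeGroup GenA3 := FreeGroup.of q
abbrev Bb : FreeGroup GenA3 := FreeGroup.of b

/-- The defining relations in the case `n = 3`. -/
inductive Rel : FreeGroup GenA3 → FreeGroup GenA3 → Prop
  | b_eq : Rel Bb (P0 * Q * P0⁻¹)
  | p0_b : Rel (P0 * Bb * P0⁻¹) (Bb ^ 2 * Q⁻¹ * Bb)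
  | p1_q : Rel (P1 * Q * P1⁻¹) (Q⁻¹ * Bb)
  | p1_b : Rel (P1 * Bb * P1⁻¹) ((Q⁻¹ * Bb) ^ 3 * (Q ^ 2)⁻¹ * Bb)

end GenA3

/-- The letters of the presentation in the case `n ≥ 4`: `p_0`, `p_1`, `b` and
`q_l` for `3 ≤ l ≤ n`. -/
inductive GenA (n : ℕ) : Type
  | p0 | p1 | b
  | q (l : ℕ) (h : 3 ≤ l ∧ l ≤ n)

namespace GenA

variable {n : ℕ}

/-- The elements of the Artin group of type `A_n` denoted by the letters. -/
def val (hn : 4 ≤ n) : GenA n → ArtinA n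
  | p0 => ArtinA.p0 (by omega)
  | p1 => ArtinA.p1 (by omega)
  | b => ArtinA.b (by omega)
  | q l h => ArtinA.q l h

/- The letters as elements of the free group. -/
abbrev P0 : FreeGroup (GenA n) := FreeGroup.of p0
abbrev P1 : FreeGroup (GenA n) := FreeGroup.of p1
abbrev Bb : FreeGroup (GenA n) := FreeGroup.of b
abbrev Q (l : ℕ) (h : 3 ≤ l ∧ l ≤ n) : FreeGroup (GenA n) :=
  FreeGroup.of (q l h)

/-- The defining relations in the case `n ≥ 4`. -/
inductive Rel (hn : 4 ≤ n) : FreeGroup (GenA n) → FreeGroup (GenA n) → Prop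
  | b_eq : Rel hn Bb (P0 * Q 3 (by omega) * P0⁻¹)
  | p0_b : Rel hn (P0 * Bb * P0⁻¹) (Bb ^ 2 * (Q 3 (by omega))⁻¹ * Bb)
  | p1_q3 : Rel hn (P1 * Q 3 (by omega) * P1⁻¹) ((Q 3 (by omega))⁻¹ * Bb)
  | p1_b : Rel hn (P1 * Bb * P1⁻¹)
      (((Q 3 (by omega))⁻¹ * Bb) ^ 3 * (Q 3 (by omega) ^ 2)⁻¹ * Bb)
  | p0_q (i : ℕ) (hi : 4 ≤ i ∧ i ≤ n) :
      Rel hn (P0 * Q i (by omega)) (Q i (by omega) * P1)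
  | p1_q (i : ℕ) (hi : 4 ≤ i ∧ i ≤ n) :
      Rel hn (P1 * Q i (by omega)) (Q i (by omega) * P0⁻¹ * P1)
  | q3_comm (i : ℕ) (hi : 5 ≤ i ∧ i ≤ n) :
      Rel hn (Q 3 (by omega) * Q i (by omega)) (Q i (by omega) * Q 3 (by omega))
  | q3_braid :
      Rel hn (Q 3 (by omega) * Q 4 (by omega) * Q 3 (by omega))
        (Q 4 (by omega) * Q 3 (by omega) * Q 4 (by omega))
  | q_comm (i j : ℕ) (hi : 4 ≤ i) (hij : i + 2 ≤ j) (hj : j ≤ n) :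
      Rel hn (Q i (by omega) * Q j (by omega)) (Q j (by omega) * Q i (by omega))
  | q_braid (i : ℕ) (hi : 4 ≤ i) (hin : i + 1 ≤ n) :
      Rel hn (Q i (by omega) * Q (i + 1) (by omega) * Q i (by omega))
        (Q (i + 1) (by omega) * Q i (by omega) * Q (i + 1) (by omega))

end GenA

/-!
The commutator subgroup of the Artin group of type `A_n` is the kernel of the exponent sum
`a_i ↦ 1`, which is split by `1 ↦ a_1`; so the Artin group is a semidirect product of its commutator
subgroup with `ℤ`, acting by conjugation by `a_1`. The proof reads this backwards. Let `K` be the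
abstract group defined by the claimed presentation. Conjugation by `a_1` suggests the substitution
`p0 ↦ p1`, `p1 ↦ p0⁻¹ p1`, `b ↦ q_3⁻¹ b`, `q_l ↦ q_l`, with inverse `p0 ↦ p0 p1⁻¹`, `p1 ↦ p0`,
`b ↦ q_3 b`, `q_l ↦ q_l`. Both preserve the relations (`IsDerivedFamily.conj`,
`IsDerivedFamily.conj_inv`), hence they give an automorphism `φ` of `K`.

The relations hold in the Artin group (`ArtinA.isDerivedFamily`), so there is a homomorphism
`f : K → ArtinA n`, and `f` carries `φ` to conjugation by `a_1`. Conversely, in `K ⋊ ⟨t⟩` the elements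
`t`, `p0 t`, `q_3 t, …, q_n t` satisfy the braid relations, which gives a homomorphism
`g : ArtinA n → K ⋊ ⟨t⟩`. On generators `g ∘ f` is the inclusion of `K`, so `f` is injective; and `g`
has a left inverse extending `f`. An element of the commutator subgroup has trivial `t`-component
under `g`, hence lies in the range of `f`; that the range lies in the commutator subgroup is seen in
the abelianization. This is `ArtinA.injective_and_range_eq_commutator`.

For `n = 2` the same argument applies with `K` the free group on `p0, p1`.
-/

/-! ### The universal property of the Artin group of type `A_n` -/

/-- The family `x 1, …, x n` satisfies the defining relations of the Artin group of type `A_n`.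
The values of `x` outside the interval `[1, n]` play no role. -/
structure IsBraidFamily {G : Type*} [Group G] (n : ℕ) (x : ℕ → G) : Prop where
  comm : ∀ i j, 1 ≤ i → i + 2 ≤ j → j ≤ n → x i * x j = x j * x i
  braid : ∀ i, 1 ≤ i → i + 1 ≤ n → x i * x (i + 1) * x i = x (i + 1) * x i * x (i + 1)

namespace ArtinA

lemma a_comm {n : ℕ} (i j : ℕ) (hi : 1 ≤ i) (hij : i + 2 ≤ j) (hj : j ≤ n) :
    (a i (by omega) * a j (by omega) : ArtinA n) = a j (by omega) * a i (by omega) := by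
  have h : (CoxeterMatrix.A n) ⟨i - 1, by omega⟩ ⟨j - 1, by omega⟩ = 2 := by
    have h1 : ¬ i - 1 = j - 1 := by omega
    have h2 : ¬ (j - 1 + 1 = i - 1 ∨ i - 1 + 1 = j - 1) := by omega
    simp [CoxeterMatrix.A, h1, h2]
  have := PresentedGroup.mk_eq_mk_of_mul_inv_mem (rels := artinRels (CoxeterMatrix.A n))
    ⟨⟨i - 1, by omega⟩, ⟨j - 1, by omega⟩, rfl⟩
  rw [h] at this
  simp only [altProd, mul_one, map_mul] at this
  exact this

lemma a_braid {n : ℕ} (i : ℕ) (hi : 1 ≤ i) (hin : i + 1 ≤ n) :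
    (a i (by omega) * a (i + 1) (by omega) * a i (by omega) : ArtinA n) =
      a (i + 1) (by omega) * a i (by omega) * a (i + 1) (by omega) := by
  have h : (CoxeterMatrix.A n) ⟨i - 1, by omega⟩ ⟨i + 1 - 1, by omega⟩ = 3 := by
    have h1 : ¬ i - 1 = i := by omega
    have h2 : i - 1 + 1 = i := by omega
    simp [CoxeterMatrix.A, h1, h2]
  have := PresentedGroup.mk_eq_mk_of_mul_inv_mem (rels := artinRels (CoxeterMatrix.A n))
    ⟨⟨i - 1, by omega⟩, ⟨i + 1 - 1, by omega⟩, rfl⟩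
  rw [h] at this
  simp only [altProd, mul_one, map_mul, ← mul_assoc] at this
  exact this

/-- The universal property of `ArtinA n`. -/
lemma exists_hom {n : ℕ} {G : Type*} [Group G] {x : ℕ → G} (hx : IsBraidFamily n x) :
    ∃ g : ArtinA n →* G, ∀ i h, g (a i h) = x i := by
  have key : ∀ r ∈ artinRels (CoxeterMatrix.A n),
      FreeGroup.lift (fun k : Fin n => x (k + 1)) r = 1 := by
    rintro _ ⟨i, j, rfl⟩
    rw [map_mul, map_inv, mul_inv_eq_one]
    by_cases hij : i = j
    · rw [hij]
    by_cases h3 : (j : ℕ) + 1 = i ∨ (i : ℕ) + 1 = j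
    · have h : (CoxeterMatrix.A n) i j = 3 := by simp [CoxeterMatrix.A, hij, h3]
      have hi := i.2
      have hj := j.2
      rcases h3 with h3 | h3
      · have := hx.braid (j + 1) (by omega) (by omega)
        simpa [h, altProd, mul_assoc, h3] using this.symm
      · have := hx.braid (i + 1) (by omega) (by omega)
        simpa [h, altProd, mul_assoc, h3] using this
    · have h : (CoxeterMatrix.A n) i j = 2 := by simp [CoxeterMatrix.A, hij, h3]
      have hi := i.2
      have hj := j.2
      have hne : (i : ℕ) ≠ j := fun h => hij (Fin.ext h)
      rcases Nat.lt_or_gt_of_ne hne with hlt | hlt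
      · have := hx.comm (i + 1) (j + 1) (by omega) (by omega) (by omega)
        simpa [h, altProd] using this
      · have := hx.comm (j + 1) (i + 1) (by omega) (by omega) (by omega)
        simpa [h, altProd] using this.symm
  refine ⟨PresentedGroup.toGroup key, fun i h => ?_⟩
  rw [a, PresentedGroup.toGroup.of]
  exact congrArg x (Nat.sub_add_cancel h.1)

lemma hom_ext {n : ℕ} {G : Type*} [Group G] {g g' : ArtinA n →* G}
    (h : ∀ i hi, g (a i hi) = g' (a i hi)) : g = g' := by
  refine PresentedGroup.ext fun k => ?_
  have := h (k + 1) ⟨by omega, k.2⟩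
  simpa [a] using this

/-- In an abelian quotient the braid relations identify consecutive generators. -/
lemma abelianization_a {n : ℕ} (i : ℕ) (h : 1 ≤ i ∧ i ≤ n) :
    Abelianization.of (a i h) = Abelianization.of (a 1 (by omega) : ArtinA n) := by
  obtain ⟨h1, h2⟩ := h
  induction i, h1 using Nat.le_induction with
  | base => rfl
  | succ i hi ih =>
    rw [← ih (by omega)]
    have := congrArg Abelianization.of (a_braid i hi h2)
    simp only [map_mul] at this
    rw [mul_comm (Abelianization.of (a (i + 1) _)) (Abelianization.of (a i _))] at this
    exact (mul_left_cancel this).symm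

/-! ### Recognizing the commutator subgroup through a semidirect product -/

/-- The criterion that reduces the computation of the commutator subgroup to the relations of a
group `K` with an automorphism `φ`, which plays the role of conjugation by `a_1`: `y i` stands for
`a_i a_1⁻¹`, and the hypotheses `hcomm` and `hbraid` say that the elements `y i * t` of
`K ⋊ ⟨t⟩` satisfy the relations of the Artin group. -/
theorem injective_and_range_eq_commutator {n : ℕ} (hn : 2 ≤ n) {K : Type*} [Group K]
    (φ : MulAut K) (f : K →* ArtinA n) (y : ℕ → K)
    (hf : ∀ k, f (φ k) = a 1 (by omega) * f k * (a 1 (by omega))⁻¹)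
    (hy1 : y 1 = 1)
    (hy : ∀ i h, f (y i) = a i h * (a 1 (by omega))⁻¹)
    (hgen : Subgroup.closure (insert (φ (y 2)) (y '' Set.Icc 1 n)) = ⊤)
    (hcomm : ∀ i j, 1 ≤ i → i + 2 ≤ j → j ≤ n → y i * φ (y j) = y j * φ (y i))
    (hbraid : ∀ i, 1 ≤ i → i + 1 ≤ n → y i * φ (y (i + 1)) * φ (φ (y i)) =
      y (i + 1) * φ (y i) * φ (φ (y (i + 1)))) :
    Function.Injective f ∧ f.range = commutator (ArtinA n) := by
  have h1n : 1 ≤ 1 ∧ 1 ≤ n := by omega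
  let Φ : Multiplicative ℤ →* MulAut K := zpowersHom (MulAut K) φ
  let t : K ⋊[Φ] Multiplicative ℤ := SemidirectProduct.inr (Multiplicative.ofAdd 1)
  have ht : ∀ k : K, t * SemidirectProduct.inl k = SemidirectProduct.inl (φ k) * t := by
    intro k
    have := SemidirectProduct.inl_aut (φ := Φ) (Multiplicative.ofAdd 1) k
    rw [show Φ (Multiplicative.ofAdd 1) = φ by simp [Φ]] at this
    rw [this, map_inv, inv_mul_cancel_right]
  have hfam : IsBraidFamily n
      (fun i => (SemidirectProduct.inl (y i) * t : K ⋊[Φ] Multiplicative ℤ)) := by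
    -- moving every `t` to the right turns the braid relations into `hcomm` and `hbraid`
    have two : ∀ k l : K, (SemidirectProduct.inl k * t) * (SemidirectProduct.inl l * t) =
        SemidirectProduct.inl (k * φ l) * (t * t) := fun k l => by
      rw [mul_assoc, ← mul_assoc t, ht, map_mul]; simp only [mul_assoc]
    have three : ∀ k l m : K, (SemidirectProduct.inl k * t) * (SemidirectProduct.inl l * t) *
        (SemidirectProduct.inl m * t) =
        SemidirectProduct.inl (k * φ l * φ (φ m)) * (t * t * t) := fun k l m => by
      rw [two, mul_assoc, mul_assoc t t, ← mul_assoc t (SemidirectProduct.inl m), ht,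
        ← mul_assoc t, ← mul_assoc t, ht, map_mul _ (k * φ l)]
      simp only [mul_assoc]
    constructor
    · intro i j hi hij hj
      simp only [two, hcomm i j hi hij hj]
    · intro i hi hin
      simp only [three, hbraid i hi hin]
  obtain ⟨g, hg⟩ := exists_hom hfam
  have hg1 : g (a 1 h1n) = t := by rw [hg, hy1, map_one, one_mul]
  have hgy : ∀ i, 1 ≤ i ∧ i ≤ n → g (f (y i)) = SemidirectProduct.inl (y i) := by
    intro i hi
    rw [hy i hi, map_mul, map_inv, hg1, hg, mul_inv_cancel_right]
  have hgf : g.comp f = SemidirectProduct.inl := by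
    refine MonoidHom.eq_of_eqOn_dense hgen ?_
    rintro _ (rfl | ⟨i, hi, rfl⟩)
    · rw [MonoidHom.comp_apply, hf, map_mul, map_mul, map_inv, hg1, hgy 2 (by omega), ht,
        mul_inv_cancel_right]
    · exact hgy i hi
  refine ⟨fun x y hxy => ?_, le_antisymm ?_ ?_⟩
  · have hx := DFunLike.congr_fun hgf x
    have hy := DFunLike.congr_fun hgf y
    simp only [MonoidHom.comp_apply] at hx hy
    rw [hxy, hy] at hx
    exact (SemidirectProduct.inl_injective hx).symm
  -- the range lies in the commutator subgroup: `f` is trivial in the abelianization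
  · have h1 : (Abelianization.of.comp f) = 1 := by
      refine MonoidHom.eq_of_eqOn_dense hgen ?_
      have hyi : ∀ i, 1 ≤ i ∧ i ≤ n → Abelianization.of (f (y i)) = 1 := fun i hi => by
        rw [hy i hi, map_mul, map_inv, abelianization_a, mul_inv_cancel]
      rintro _ (rfl | ⟨i, hi, rfl⟩)
      · rw [MonoidHom.comp_apply, hf, map_mul, map_mul, hyi 2 (by omega), mul_one, map_inv,
          mul_inv_cancel, MonoidHom.one_apply]
      · exact hyi i hi
    rintro _ ⟨k, rfl⟩
    rw [← Abelianization.ker_of]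
    exact DFunLike.congr_fun h1 k
  · intro x hx
    -- `h` is a left inverse of `g` that extends `f`, and `g x` lies in `K`
    let h : K ⋊[Φ] Multiplicative ℤ →* ArtinA n :=
      SemidirectProduct.lift f (zpowersHom _ (a 1 h1n)) (by
        intro z
        -- the equivariance `hf` passes from `φ` to its integral powers
        have hz : ∀ z : ℤ, ∀ k, f ((φ ^ z) k) = a 1 h1n ^ z * f k * (a 1 h1n ^ z)⁻¹ := by
          intro z
          induction z using Int.induction_on with
          | zero => simp
          | succ m ih =>
            intro k
            rw [zpow_add_one, zpow_add_one, MulAut.mul_apply, ih, hf]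
            group
          | pred m ih =>
            intro k
            have h' : f (φ⁻¹ k) = (a 1 h1n)⁻¹ * f k * a 1 h1n := by
              have := hf (φ⁻¹ k)
              rw [MulAut.apply_inv_self] at this
              rw [this]
              group
            rw [zpow_sub_one, zpow_sub_one, MulAut.mul_apply, ih, h']
            group
        refine MonoidHom.ext fun k => ?_
        simpa [Φ, ← map_zpow] using hz z.toAdd k)
    have hhg : h.comp g = MonoidHom.id _ := hom_ext fun i hi => by
      simp [h, t, hg, hy i hi, SemidirectProduct.lift_inl, SemidirectProduct.lift_inr]
    have hright : (g x).right = 1 :=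
      Abelianization.commutator_subset_ker (SemidirectProduct.rightHom.comp g) hx
    refine ⟨(g x).left, ?_⟩
    have h2 := DFunLike.congr_fun hhg x
    rw [MonoidHom.comp_apply, ← SemidirectProduct.inl_left_mul_inr_right (g x), hright,
      map_one, mul_one] at h2
    simpa [h] using h2

end ArtinA

/-! ### The relations of the presentation -/

/-- The relations of the presentation for `n ≥ 3`, as a property of elements
`p0, p1, b, q 3, …, q n` of an arbitrary group. For `n = 3` only the first four are not void. -/
structure IsDerivedFamily {G : Type*} [Group G] (n : ℕ) (p0 p1 b : G) (q : ℕ → G) : Prop where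
  b_eq : b = p0 * q 3 * p0⁻¹
  p0_b : p0 * b * p0⁻¹ = b ^ 2 * (q 3)⁻¹ * b
  p1_q3 : p1 * q 3 * p1⁻¹ = (q 3)⁻¹ * b
  p1_b : p1 * b * p1⁻¹ = ((q 3)⁻¹ * b) ^ 3 * (q 3 ^ 2)⁻¹ * b
  p0_q : ∀ i, 4 ≤ i → i ≤ n → p0 * q i = q i * p1
  p1_q : ∀ i, 4 ≤ i → i ≤ n → p1 * q i = q i * p0⁻¹ * p1
  q_comm : ∀ i j, 3 ≤ i → i + 2 ≤ j → j ≤ n → q i * q j = q j * q i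
  q_braid : ∀ i, 3 ≤ i → i + 1 ≤ n → q i * q (i + 1) * q i = q (i + 1) * q i * q (i + 1)

namespace IsDerivedFamily

variable {G : Type*} [Group G] {n : ℕ} {p0 p1 b : G} {q : ℕ → G}

/-- The relations are preserved by the substitution that conjugation by `a_1` induces. -/
lemma conj (h : IsDerivedFamily n p0 p1 b q) :
    IsDerivedFamily n p1 (p0⁻¹ * p1) ((q 3)⁻¹ * b) q := by
  have c0 : MulAut.conj p0 (q 3) = b := h.b_eq.symm
  have c0' : MulAut.conj p0 b = b ^ 2 * (q 3)⁻¹ * b := h.p0_b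
  have c1 : MulAut.conj p1 (q 3) = (q 3)⁻¹ * b := h.p1_q3
  have c1' : MulAut.conj p1 b = ((q 3)⁻¹ * b) ^ 3 * (q 3 ^ 2)⁻¹ * b := h.p1_b
  refine ⟨h.p1_q3.symm, ?_, ?_, ?_,
    fun i hi hin => by rw [h.p1_q i hi hin, mul_assoc], ?_, h.q_comm, h.q_braid⟩
  · change MulAut.conj p1 ((q 3)⁻¹ * b) = _
    simp only [map_mul, map_inv, c1, c1']
    simp [pow_succ, mul_assoc]
  -- after conjugation by `p0` both sides become words in `q 3` and `b`, equal in the free group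
  · change MulAut.conj (p0⁻¹ * p1) (q 3) = _
    apply (MulAut.conj p0).injective
    rw [map_mul MulAut.conj, map_inv, MulAut.mul_apply, MulAut.apply_inv_self]
    simp only [map_mul, map_inv, c0, c0', c1]
    simp [pow_succ, mul_assoc]
  · change MulAut.conj (p0⁻¹ * p1) ((q 3)⁻¹ * b) = _
    apply (MulAut.conj p0).injective
    rw [map_mul MulAut.conj, map_inv, MulAut.mul_apply, MulAut.apply_inv_self]
    simp only [map_mul, map_inv, map_pow, c0, c0', c1, c1']
    simp [pow_succ, mul_assoc]
  · intro i hi hin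
    rw [mul_assoc, h.p1_q i hi hin, mul_assoc, ← mul_assoc p0⁻¹,
      show p0⁻¹ * q i = q i * p1⁻¹ by
        rw [inv_mul_eq_iff_eq_mul, ← mul_assoc, h.p0_q i hi hin, mul_inv_cancel_right]]

/-- The relations are preserved by the substitution that conjugation by `a_1⁻¹` induces. -/
lemma conj_inv (h : IsDerivedFamily n p0 p1 b q) :
    IsDerivedFamily n (p0 * p1⁻¹) p0 (q 3 * b) q := by
  have c0 : MulAut.conj p0 (q 3) = b := h.b_eq.symm
  have c0' : MulAut.conj p0 b = b ^ 2 * (q 3)⁻¹ * b := h.p0_b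
  -- conjugation by `p1` acts on the subgroup generated by `q 3` and `b`; the inverse action is
  -- obtained by solving `p1_q3` and `p1_b` for `q 3` and `b`
  have c1 : (MulAut.conj p1)⁻¹ (q 3) = q 3 * b⁻¹ * q 3 ^ 3 := by
    rw [MulAut.inv_apply, MulEquiv.symm_apply_eq]
    have c1 : MulAut.conj p1 (q 3) = (q 3)⁻¹ * b := h.p1_q3
    have c1' : MulAut.conj p1 b = ((q 3)⁻¹ * b) ^ 3 * (q 3 ^ 2)⁻¹ * b := h.p1_b
    simp only [map_mul, map_inv, map_pow, c1, c1']
    simp [pow_succ, mul_assoc]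
  have c1' : (MulAut.conj p1)⁻¹ b = q 3 * b⁻¹ * q 3 ^ 4 := by
    rw [MulAut.inv_apply, MulEquiv.symm_apply_eq]
    have c1 : MulAut.conj p1 (q 3) = (q 3)⁻¹ * b := h.p1_q3
    have c1' : MulAut.conj p1 b = ((q 3)⁻¹ * b) ^ 3 * (q 3 ^ 2)⁻¹ * b := h.p1_b
    simp only [map_mul, map_inv, map_pow, c1, c1']
    simp [pow_succ, mul_assoc]
  have p1_q' : ∀ i, 4 ≤ i → i ≤ n → p1⁻¹ * q i = q i * p1⁻¹ * p0 := fun i hi hin => by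
    rw [inv_mul_eq_iff_eq_mul, ← mul_assoc, ← mul_assoc, h.p1_q i hi hin]
    simp [mul_assoc]
  refine ⟨?_, ?_, ?_, ?_, ?_, ?_, h.q_comm, h.q_braid⟩
  · change _ = MulAut.conj (p0 * p1⁻¹) (q 3)
    rw [map_mul MulAut.conj, map_inv, MulAut.mul_apply]
    simp only [map_mul, map_inv, map_pow, c0, c0', c1]
    simp [pow_succ, mul_assoc]
  · change MulAut.conj (p0 * p1⁻¹) (q 3 * b) = _
    rw [map_mul MulAut.conj, map_inv, MulAut.mul_apply]
    simp only [map_mul, map_inv, map_pow, c0, c0', c1, c1']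
    simp [pow_succ, mul_assoc]
  · rw [← h.b_eq]
    simp
  · change MulAut.conj p0 (q 3 * b) = _
    simp only [map_mul, c0, c0']
    simp [pow_succ, mul_assoc]
  · intro i hi hin
    rw [mul_assoc, p1_q' i hi hin, ← mul_assoc, ← mul_assoc, h.p0_q i hi hin,
      mul_inv_cancel_right]
  · intro i hi hin
    rw [h.p0_q i hi hin]
    simp [mul_assoc]

end IsDerivedFamily

namespace ArtinA

/-! ### The relations hold in the Artin group -/

/-- `q_l` as a function of all natural numbers, with value `1` outside the range `3 ≤ l ≤ n`. -/
def qTotal (n l : ℕ) : ArtinA n :=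
  if h : 3 ≤ l ∧ l ≤ n then q l h else 1

lemma qTotal_eq {n l : ℕ} (h : 3 ≤ l ∧ l ≤ n) : qTotal n l = q l h := dif_pos h

lemma conj_q {n : ℕ} (l : ℕ) (h : 3 ≤ l ∧ l ≤ n) :
    a 1 (by omega) * (q l h : ArtinA n) * (a 1 (by omega))⁻¹ = q l h := by
  rw [q, ← mul_assoc, a_comm 1 l le_rfl (by omega) (by omega), mul_inv_cancel_right]

lemma conj_p0 {n : ℕ} (hn : 2 ≤ n) :
    a 1 (by omega) * (p0 hn : ArtinA n) * (a 1 (by omega))⁻¹ = p1 hn := by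
  rw [p0, p1]
  group

/-- This is the braid relation between `a_1` and `a_2`. -/
lemma conj_p1 {n : ℕ} (hn : 2 ≤ n) :
    a 1 (by omega) * (p1 hn : ArtinA n) * (a 1 (by omega))⁻¹ = (p0 hn)⁻¹ * p1 hn := by
  have h : (a 1 (by omega) * a 2 (by omega) * a 1 (by omega) : ArtinA n) =
    a 2 (by omega) * a 1 (by omega) * a 2 (by omega) := a_braid 1 le_rfl hn
  rw [eq_inv_mul_iff_mul_eq, p0, p1]
  generalize (a 1 _ : ArtinA n) = x at *
  generalize (a 2 _ : ArtinA n) = y at *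
  calc y * x⁻¹ * (x * (x * y * (x ^ 2)⁻¹) * x⁻¹) = (y * x * y) * (x⁻¹ * x⁻¹ * x⁻¹) := by group
    _ = x * y * (x ^ 2)⁻¹ := by rw [← h]; group

/-- The relation `b_eq` is the definition of `b`, and `p1_q3` is the braid relation between `a_2` and
`a_3`. Conjugation by `a_1` then turns `p1_q3` into `p0_b`, and `p0_b` into `p1_b`; likewise `p0_q`,
which is the commutation of `a_2` and `a_i`, turns into `p1_q`. -/
theorem isDerivedFamily {n : ℕ} (hn : 3 ≤ n) :
    IsDerivedFamily n (p0 (by omega)) (p1 (by omega)) (b hn) (qTotal n) := by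
  have h2 : 2 ≤ n := by omega
  have h1n : 1 ≤ 1 ∧ 1 ≤ n := by omega
  have hq := qTotal_eq (n := n) (l := 3) (by omega)
  let c : MulAut (ArtinA n) := MulAut.conj (a 1 h1n)
  have cp0 : c (p0 h2) = p1 h2 := conj_p0 h2
  have cp1 : c (p1 h2) = (p0 h2)⁻¹ * p1 h2 := conj_p1 h2
  have cq : ∀ l, 3 ≤ l → l ≤ n → c (qTotal n l) = qTotal n l := fun l hl hln => by
    rw [qTotal_eq ⟨hl, hln⟩]
    exact conj_q l ⟨hl, hln⟩
  have hqa : ∀ l, (hl : 3 ≤ l) → (h : l ≤ n) →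
      (a l ⟨by omega, h⟩ : ArtinA n) = qTotal n l * a 1 h1n := fun l hl h => by
    rw [qTotal_eq ⟨hl, h⟩, q, inv_mul_cancel_right]
  have hpa : (a 2 ⟨by omega, h2⟩ : ArtinA n) = p0 h2 * a 1 h1n := by rw [p0, inv_mul_cancel_right]
  have hqc : ∀ l, 3 ≤ l → l ≤ n → a 1 h1n * qTotal n l = qTotal n l * a 1 h1n :=
    fun l hl h => by
      have := cq l hl h
      rwa [MulAut.conj_apply, mul_inv_eq_iff_eq_mul] at this
  have b_eq : b hn = p0 h2 * qTotal n 3 * (p0 h2)⁻¹ := by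
    rw [hq, b, p0, q]
    group
  have p1_q3 : p1 h2 * qTotal n 3 * (p1 h2)⁻¹ = (qTotal n 3)⁻¹ * b hn := by
    have h := a_braid (n := n) 2 (by omega) (by omega)
    rw [hpa, hqa 3 le_rfl hn] at h
    have hc := hqc 3 le_rfl hn
    rw [mul_inv_eq_iff_eq_mul, mul_assoc, eq_inv_mul_iff_mul_eq, b_eq]
    have e3 : c (p1 h2) = a 1 h1n ^ 2 * p0 h2 * (a 1 h1n ^ 2)⁻¹ := by
      rw [← cp0, MulAut.conj_apply, MulAut.conj_apply]
      simp [pow_succ, mul_assoc]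
    have e1 : p1 h2 = a 1 h1n * p0 h2 * (a 1 h1n)⁻¹ := cp0.symm
    rw [mul_assoc, mul_assoc, ← cp1, e3, e1]
    generalize (a 1 _ : ArtinA n) = x at *
    generalize qTotal n 3 = q at *
    generalize p0 h2 = p at *
    have hc'' : q * x⁻¹ = x⁻¹ * q := by
      rw [eq_inv_mul_iff_mul_eq, ← mul_assoc, hc, mul_inv_cancel_right]
    calc q * (x * p * x⁻¹ * q) = (q * x) * p * (x⁻¹ * q) := by group
      _ = (q * x) * p * (q * x⁻¹) := by rw [hc'']
      _ = (q * x * (p * x) * (x⁻¹ * q)) * x⁻¹ := by group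
      _ = (q * x * (p * x) * (q * x)) * x⁻¹ ^ 3 := by rw [← hc'']; group
      _ = p * x * (q * x) * (p * x) * x⁻¹ ^ 3 := by rw [h]
      _ = p * (x * q) * x * p * (x⁻¹ * x⁻¹) := by group
      _ = _ := by rw [hc]; simp [pow_succ, mul_assoc]
  have cb : c (b hn) = (qTotal n 3)⁻¹ * b hn := by
    rw [b_eq, map_mul, map_mul, map_inv, cp0, cq 3 le_rfl hn, p1_q3, b_eq]
  have p0_b : p0 h2 * b hn * (p0 h2)⁻¹ = b hn ^ 2 * (qTotal n 3)⁻¹ * b hn := by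
    have h := congrArg c p1_q3
    simp only [map_mul, map_inv, cp1, cq 3 le_rfl hn, cb] at h
    have h' : p1 h2 * qTotal n 3 * (p1 h2)⁻¹ =
        p0 h2 * ((qTotal n 3)⁻¹ * ((qTotal n 3)⁻¹ * b hn)) * (p0 h2)⁻¹ := by
      rw [← h]
      group
    rw [p1_q3] at h'
    have d : MulAut.conj (p0 h2) (qTotal n 3) = b hn := b_eq.symm
    have h'' : (qTotal n 3)⁻¹ * b hn =
        MulAut.conj (p0 h2) ((qTotal n 3)⁻¹ * ((qTotal n 3)⁻¹ * b hn)) := h'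
    simp only [map_mul, map_inv, d] at h''
    rw [eq_inv_mul_iff_mul_eq, eq_inv_mul_iff_mul_eq, MulAut.conj_apply] at h''
    rw [← h'']
    simp [pow_succ, mul_assoc]
  have p1_b : p1 h2 * b hn * (p1 h2)⁻¹ =
      ((qTotal n 3)⁻¹ * b hn) ^ 3 * (qTotal n 3 ^ 2)⁻¹ * b hn := by
    have h := congrArg c p0_b
    simp only [map_mul, map_inv, map_pow, cp0, cq 3 le_rfl hn, cb] at h
    have d : MulAut.conj (p1 h2) (qTotal n 3) = (qTotal n 3)⁻¹ * b hn := p1_q3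
    have h' : MulAut.conj (p1 h2) ((qTotal n 3)⁻¹ * b hn) = _ := h
    rw [map_mul, map_inv, d, inv_mul_eq_iff_eq_mul, MulAut.conj_apply] at h'
    rw [h']
    simp [pow_succ, mul_assoc]
  have p0_q : ∀ i, 4 ≤ i → i ≤ n → p0 h2 * qTotal n i = qTotal n i * p1 h2 := fun i hi hin => by
    have h := a_comm (n := n) 2 i (by omega) (by omega) hin
    rw [hpa, hqa i (by omega) hin] at h
    rw [← cp0, MulAut.conj_apply, ← mul_assoc, ← mul_assoc, eq_mul_inv_iff_mul_eq]
    refine mul_right_cancel (b := a 1 h1n) ?_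
    calc p0 h2 * qTotal n i * a 1 h1n * a 1 h1n
        = p0 h2 * a 1 h1n * (qTotal n i * a 1 h1n) := by
          rw [mul_assoc (p0 h2) (a 1 h1n), ← mul_assoc (a 1 h1n), hqc i (by omega) hin]
          simp only [mul_assoc]
      _ = qTotal n i * a 1 h1n * p0 h2 * a 1 h1n := by rw [h, ← mul_assoc]
  refine ⟨b_eq, p0_b, p1_q3, p1_b, p0_q, fun i hi hin => ?_, fun i j hi hij hj => ?_,
    fun i hi hin => ?_⟩
  · have h := congrArg c (p0_q i hi hin)
    simpa only [map_mul, cp0, cp1, cq i (by omega) hin, ← mul_assoc] using h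
  · have h := a_comm (n := n) i j (by omega) hij hj
    rw [hqa i hi (by omega), hqa j (by omega) hj] at h
    have hi' := hqc i hi (by omega)
    have hj' := hqc j (by omega) hj
    generalize (a 1 _ : ArtinA n) = x at *
    have key : ∀ u v : ArtinA n, x * v = v * x → u * x * (v * x) = u * v * (x * x) :=
      fun u v hv => by rw [mul_assoc, ← mul_assoc x, hv]; simp only [mul_assoc]
    rw [key _ _ hj', key _ _ hi'] at h
    exact mul_right_cancel h
  · have h := a_braid (n := n) i (by omega) hin
    rw [hqa i hi (by omega), hqa (i + 1) (by omega) hin] at h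
    have hi' := hqc i hi (by omega)
    have hj' := hqc (i + 1) (by omega) hin
    generalize (a 1 _ : ArtinA n) = x at *
    generalize qTotal n i = u at *
    generalize qTotal n (i + 1) = v at *
    have key : ∀ u v : ArtinA n, x * u = u * x → x * v = v * x →
        u * x * (v * x) * (u * x) = u * v * u * (x * x * x) := fun u v hu hv => by
      have hu' : x * x * u = u * (x * x) := by rw [mul_assoc, hu, ← mul_assoc, hu, mul_assoc]
      calc u * x * (v * x) * (u * x) = u * (x * v) * x * u * x := by simp only [mul_assoc]
        _ = u * v * (x * x * u) * x := by rw [hv]; simp only [mul_assoc]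
        _ = _ := by rw [hu']; simp only [mul_assoc]
    rw [key u v hi' hj', key v u hj' hi'] at h
    exact mul_right_cancel h

end ArtinA

lemma IsDerivedFamily.congr {G : Type*} [Group G] {n : ℕ} (hn : 3 ≤ n) {p0 p1 b : G}
    {q q' : ℕ → G} (hq : ∀ l, 3 ≤ l → l ≤ n → q l = q' l) (h : IsDerivedFamily n p0 p1 b q) :
    IsDerivedFamily n p0 p1 b q' := by
  have h3 := hq 3 le_rfl hn
  refine ⟨?_, ?_, ?_, ?_, fun i hi hin => ?_, fun i hi hin => ?_, fun i j hi hij hj => ?_,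
    fun i hi hin => ?_⟩
  · rw [← h3]; exact h.b_eq
  · rw [← h3]; exact h.p0_b
  · rw [← h3]; exact h.p1_q3
  · rw [← h3]; exact h.p1_b
  · rw [← hq i (by omega) hin]; exact h.p0_q i hi hin
  · rw [← hq i (by omega) hin]; exact h.p1_q i hi hin
  · rw [← hq i hi (by omega), ← hq j (by omega) hj]; exact h.q_comm i j hi hij hj
  · rw [← hq i hi (by omega), ← hq (i + 1) (by omega) hin]; exact h.q_braid i hi hin

/-! ### From the relations to the presentation -/

/-- A presentation on letters `e0`, `e1`, `eb`, `eq 3, …, eq n` whose relations say exactly that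
the letters form a derived family is a presentation of the commutator subgroup. The hypotheses `hι` and
`hletters` say that the letters are exhausted by these and can be given arbitrary values. -/
theorem hasPresentation_commutator {n : ℕ} (hn : 3 ≤ n) {ι : Type}
    (R : FreeGroup ι → FreeGroup ι → Prop) (e0 e1 eb : ι) (eq : ℕ → ι)
    (hι : ∀ i, i = e0 ∨ i = e1 ∨ i = eb ∨ ∃ l, 3 ≤ l ∧ l ≤ n ∧ i = eq l)
    (hletters : ∀ (G : Type) (x0 x1 xb : G) (y : ℕ → G), ∃ v : ι → G,
      v e0 = x0 ∧ v e1 = x1 ∧ v eb = xb ∧ ∀ l, 3 ≤ l → l ≤ n → v (eq l) = y l)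
    (hR : ∀ (G : Type) [Group G] (v : ι → G),
      (∀ r s, R r s → FreeGroup.lift v r = FreeGroup.lift v s) ↔
        IsDerivedFamily n (v e0) (v e1) (v eb) (fun l => v (eq l)))
    (val : ι → ArtinA n) (h0 : val e0 = ArtinA.p0 (by omega)) (h1 : val e1 = ArtinA.p1 (by omega))
    (hb : val eb = ArtinA.b hn) (hq : ∀ l h, val (eq l) = ArtinA.q l h) :
    HasPresentation (commutator (ArtinA n)) val R := by
  let e : ι → PresentedGroup (relatorSet R) := PresentedGroup.of
  have hK : IsDerivedFamily n (e e0) (e e1) (e eb) (fun l => e (eq l)) := by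
    refine (hR _ e).1 fun r s hrs => ?_
    have hmk : FreeGroup.lift e = PresentedGroup.mk (relatorSet R) := by
      ext i
      simp [e, PresentedGroup.of]
    rw [hmk]
    exact PresentedGroup.mk_eq_mk_of_mul_inv_mem ⟨r, s, hrs, rfl⟩
  -- the universal property of the presented group: existence, then uniqueness
  have hU : ∀ {G : Type} [Group G] {x0 x1 xb : G} {y : ℕ → G}, IsDerivedFamily n x0 x1 xb y →
      ∃ F : PresentedGroup (relatorSet R) →* G, F (e e0) = x0 ∧ F (e e1) = x1 ∧ F (e eb) = xb ∧
        ∀ l, 3 ≤ l → l ≤ n → F (e (eq l)) = y l := by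
    intro G _ x0 x1 xb y hy
    obtain ⟨v, rfl, rfl, rfl, hv⟩ := hletters G x0 x1 xb y
    have hrel := (hR G v).2 (hy.congr hn fun l hl hln => (hv l hl hln).symm)
    have key : ∀ r ∈ relatorSet R, FreeGroup.lift v r = 1 := by
      rintro _ ⟨r, s, hrs, rfl⟩
      rw [map_mul, map_inv, hrel r s hrs, mul_inv_cancel]
    refine ⟨PresentedGroup.toGroup key, PresentedGroup.toGroup.of key,
      PresentedGroup.toGroup.of key, PresentedGroup.toGroup.of key, fun l hl hln => ?_⟩
    rw [← hv l hl hln]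
    exact PresentedGroup.toGroup.of key
  have hext : ∀ {G : Type} [Group G] {F F' : PresentedGroup (relatorSet R) →* G},
      F (e e0) = F' (e e0) → F (e e1) = F' (e e1) → F (e eb) = F' (e eb) →
      (∀ l, 3 ≤ l → l ≤ n → F (e (eq l)) = F' (e (eq l))) → F = F' := by
    intro G _ F F' g0 g1 gb gq
    refine PresentedGroup.ext fun i => ?_
    rcases hι i with rfl | rfl | rfl | ⟨l, hl, hln, rfl⟩
    exacts [g0, g1, gb, gq l hl hln]
  obtain ⟨φ, φ0, φ1, φb, φq⟩ := hU hK.conj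
  obtain ⟨ψ, ψ0, ψ1, ψb, ψq⟩ := hU hK.conj_inv
  obtain ⟨f, f0, f1, fb, fq⟩ := hU (ArtinA.isDerivedFamily hn)
  let Φ : MulAut (PresentedGroup (relatorSet R)) := MonoidHom.toMulEquiv φ ψ
    (hext (by simp [φ0, ψ1]) (by simp [φ1, ψ0, ψ1]) (by simp [φb, ψb, ψq 3 le_rfl hn])
      fun l hl hln => by simp [φq l hl hln, ψq l hl hln])
    (hext (by simp [ψ0, φ0, φ1]) (by simp [ψ1, φ0]) (by simp [ψb, φb, φq 3 le_rfl hn])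
      fun l hl hln => by simp [φq l hl hln, ψq l hl hln])
  have hΦ : ∀ k, Φ k = φ k := fun k => rfl
  let y : ℕ → PresentedGroup (relatorSet R) := fun i =>
    if i = 1 then 1 else if i = 2 then e e0 else e (eq i)
  have y1 : y 1 = 1 := rfl
  have y2 : y 2 = e e0 := rfl
  have yq : ∀ l, 3 ≤ l → y l = e (eq l) := fun l hl => by
    simp only [y]
    rw [if_neg (by omega), if_neg (by omega)]
  have φy : ∀ l, 3 ≤ l → l ≤ n → φ (y l) = y l := fun l hl hln => by rw [yq l hl, φq l hl hln]
  have hf : f.comp φ = (MulAut.conj (ArtinA.a 1 (by omega))).toMonoidHom.comp f := by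
    have cp0 := ArtinA.conj_p0 (n := n) (by omega)
    have cp1 := ArtinA.conj_p1 (n := n) (by omega)
    have cq : ∀ l, 3 ≤ l → l ≤ n → MulAut.conj (ArtinA.a 1 (by omega)) (ArtinA.qTotal n l) =
        ArtinA.qTotal n l := fun l hl hln => by
      rw [ArtinA.qTotal_eq ⟨hl, hln⟩]
      exact ArtinA.conj_q l ⟨hl, hln⟩
    refine hext ?_ ?_ ?_ fun l hl hln => ?_
    · simp [φ0, f0, f1, cp0]
    · simp [φ1, f0, f1, cp1]
    · have D := ArtinA.isDerivedFamily hn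
      simp only [MonoidHom.comp_apply, φb, map_mul, map_inv, fb, fq 3 le_rfl hn]
      rw [MulEquiv.toMonoidHom_eq_coe, MonoidHom.coe_coe, ← D.p1_q3]
      conv_rhs => rw [D.b_eq]
      rw [map_mul, map_mul, cq 3 le_rfl hn, map_inv, MulAut.conj_apply, cp0]
    · simpa [φq l hl hln, fq l hl hln] using (cq l hl hln).symm
  obtain ⟨hinj, hrange⟩ := ArtinA.injective_and_range_eq_commutator (n := n) (by omega) Φ f y
    (fun k => DFunLike.congr_fun hf k) y1
    (by
      intro i hi
      obtain rfl | rfl | hi3 : i = 1 ∨ i = 2 ∨ 3 ≤ i := by omega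
      · rw [y1, map_one, mul_inv_cancel]
      · rw [y2, f0, ArtinA.p0]
      · rw [yq i hi3, fq i hi3 hi.2, ArtinA.qTotal_eq ⟨hi3, hi.2⟩, ArtinA.q])
    (by
      rw [eq_top_iff, ← PresentedGroup.closure_range_of, Subgroup.closure_le]
      set S := Subgroup.closure (insert (Φ (y 2)) (y '' Set.Icc 1 n))
      have hy : ∀ i, 1 ≤ i → i ≤ n → y i ∈ S := fun i hi hin =>
        Subgroup.subset_closure (Or.inr ⟨i, ⟨hi, hin⟩, rfl⟩)
      have m0 : e e0 ∈ S := hy 2 (by omega) (by omega)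
      have mq : ∀ l, 3 ≤ l → l ≤ n → e (eq l) ∈ S := fun l hl hln => by
        rw [← yq l hl]
        exact hy l (by omega) hln
      rintro _ ⟨i, rfl⟩
      change e i ∈ S
      rcases hι i with rfl | rfl | rfl | ⟨l, hl, hln, rfl⟩
      · exact m0
      · rw [← φ0]
        exact Subgroup.subset_closure (Or.inl rfl)
      · rw [hK.b_eq]
        exact S.mul_mem (S.mul_mem m0 (mq 3 le_rfl hn)) (S.inv_mem m0)
      · exact mq l hl hln)
    (by
      intro i j hi hij hj
      simp only [hΦ, φy j (by omega) hj]
      obtain rfl | rfl | hi3 : i = 1 ∨ i = 2 ∨ 3 ≤ i := by omega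
      · rw [y1, map_one, one_mul, mul_one]
      · rw [y2, φ0, yq j (by omega)]
        exact hK.p0_q j (by omega) hj
      · rw [φy i hi3 (by omega), yq i hi3, yq j (by omega)]
        exact hK.q_comm i j hi3 hij hj)
    (by
      intro i hi hin
      simp only [hΦ]
      obtain rfl | rfl | hi3 : i = 1 ∨ i = 2 ∨ 3 ≤ i := by omega
      · rw [y1, y2, map_one, map_one, φ0, φ1, mul_one, mul_one, one_mul, mul_inv_cancel_left]
      · -- the braid relation between `a_2` and `a_3` amounts to `b * p1 = q 3 * p1 * q 3`
        rw [φy 3 le_rfl hn, φy 3 le_rfl hn, y2, φ0, φ1, yq 3 le_rfl]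
        have h3 := hK.p1_q3
        rw [mul_inv_eq_iff_eq_mul, mul_assoc, eq_inv_mul_iff_mul_eq, hK.b_eq] at h3
        rw [mul_assoc (e (eq 3)), h3]
        simp only [mul_assoc]
      · rw [φy i hi3 (by omega), φy i hi3 (by omega), φy (i + 1) (by omega) hin,
          φy (i + 1) (by omega) hin, yq i hi3, yq (i + 1) (by omega)]
        exact hK.q_braid i hi3 hin)
  have hval : FreeGroup.lift val = f.comp (PresentedGroup.mk (relatorSet R)) := by
    ext i
    have hi : f (e i) = val i := by
      rcases hι i with rfl | rfl | rfl | ⟨l, hl, hln, rfl⟩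
      · rw [f0, h0]
      · rw [f1, h1]
      · rw [fb, hb]
      · rw [fq l hl hln, hq l ⟨hl, hln⟩, ArtinA.qTotal_eq]
    rw [FreeGroup.lift_apply_of, ← hi]
    rfl
  constructor
  · rw [← hrange, hval, MonoidHom.range_comp,
      MonoidHom.range_eq_top.2 (PresentedGroup.mk_surjective _), ← MonoidHom.range_eq_map]
  · ext x
    rw [hval, MonoidHom.mem_ker, MonoidHom.comp_apply, map_eq_one_iff f hinj,
      PresentedGroup.mk_eq_one_iff]

/-! ### The presentations for `n ≥ 3` -/

theorem hasPresentation_A3 : HasPresentation (commutator (ArtinA 3)) GenA3.val GenA3.Rel := by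
  refine hasPresentation_commutator (le_refl 3) _ .p0 .p1 .b (fun _ => .q) ?_ ?_ ?_ _ rfl rfl rfl ?_
  · rintro (_ | _ | _ | _)
    · exact Or.inl rfl
    · exact Or.inr (Or.inl rfl)
    · exact Or.inr (Or.inr (Or.inr ⟨3, le_rfl, le_rfl, rfl⟩))
    · exact Or.inr (Or.inr (Or.inl rfl))
  · refine fun G x0 x1 xb y =>
      ⟨fun | .p0 => x0 | .p1 => x1 | .b => xb | .q => y 3, rfl, rfl, rfl, fun l hl hln => ?_⟩
    rw [le_antisymm hln hl]
  · refine fun G _ v => ⟨fun h => ?_, fun h r s hrs => ?_⟩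
    · refine ⟨by simpa using h _ _ .b_eq, by simpa using h _ _ .p0_b, by simpa using h _ _ .p1_q,
        by simpa using h _ _ .p1_b, ?_, ?_, ?_, ?_⟩ <;> intros <;> omega
    · cases hrs with
      | b_eq => simpa using h.b_eq
      | p0_b => simpa using h.p0_b
      | p1_q => simpa using h.p1_q3
      | p1_b => simpa using h.p1_b
  · intro l h
    obtain rfl : l = 3 := le_antisymm h.2 h.1
    rfl

theorem hasPresentation_A {n : ℕ} (hn : 4 ≤ n) :
    HasPresentation (commutator (ArtinA n)) (GenA.val hn) (GenA.Rel hn) := by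
  -- `q_l` as a letter for every `l`, with an irrelevant value outside the range `3 ≤ l ≤ n`
  obtain ⟨letter, e⟩ : ∃ letter : ℕ → GenA n, ∀ l h, letter l = .q l h :=
    ⟨fun l => if h : 3 ≤ l ∧ l ≤ n then .q l h else .p0, fun l h => dif_pos h⟩
  refine hasPresentation_commutator (n := n) (by omega) _ .p0 .p1 .b letter ?_ ?_ ?_ _
    rfl rfl rfl ?_
  · rintro (_ | _ | _ | ⟨l, h⟩)
    · exact Or.inl rfl
    · exact Or.inr (Or.inl rfl)
    · exact Or.inr (Or.inr (Or.inl rfl))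
    · exact Or.inr (Or.inr (Or.inr ⟨l, h.1, h.2, (e l h).symm⟩))
  · refine fun G x0 x1 xb y =>
      ⟨fun | .p0 => x0 | .p1 => x1 | .b => xb | .q l _ => y l, rfl, rfl, rfl, fun l hl hln => ?_⟩
    rw [e l ⟨hl, hln⟩]
  · refine fun G _ v => ⟨fun h => ?_, fun h r s hrs => ?_⟩
    · have e3 := e 3 (by omega)
      refine ⟨?_, ?_, ?_, ?_, fun i hi hin => ?_, fun i hi hin => ?_, fun i j hi hij hj => ?_,
        fun i hi hin => ?_⟩
      · simpa [e3] using h _ _ .b_eq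
      · simpa [e3] using h _ _ .p0_b
      · simpa [e3] using h _ _ .p1_q3
      · simpa [e3] using h _ _ .p1_b
      · simpa [e i (by omega)] using h _ _ (.p0_q i ⟨hi, hin⟩)
      · simpa [e i (by omega)] using h _ _ (.p1_q i ⟨hi, hin⟩)
      · rw [e i (by omega), e j (by omega)]
        obtain rfl | hi4 := hi.eq_or_lt
        · simpa using h _ _ (.q3_comm j ⟨hij, hj⟩)
        · simpa using h _ _ (.q_comm i j hi4 hij hj)
      · rw [e i (by omega), e (i + 1) (by omega)]
        obtain rfl | hi4 := hi.eq_or_lt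
        · simpa using h _ _ .q3_braid
        · simpa using h _ _ (.q_braid i hi4 hin)
    · have e3 := e 3 (by omega)
      cases hrs with
      | b_eq => simpa [e3] using h.b_eq
      | p0_b => simpa [e3] using h.p0_b
      | p1_q3 => simpa [e3] using h.p1_q3
      | p1_b => simpa [e3] using h.p1_b
      | p0_q i hi => simpa [e i (by omega)] using h.p0_q i hi.1 hi.2
      | p1_q i hi => simpa [e i (by omega)] using h.p1_q i hi.1 hi.2
      | q3_comm i hi =>
        simpa [e3, e i (by omega)] using h.q_comm 3 i le_rfl hi.1 hi.2
      | q3_braid => simpa [e3, e 4 (by omega)] using h.q_braid 3 le_rfl hn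
      | q_comm i j hi hij hj =>
        simpa [e i (by omega), e j (by omega)] using h.q_comm i j (by omega) hij hj
      | q_braid i hi hin =>
        simpa [e i (by omega), e (i + 1) (by omega)] using h.q_braid i (by omega) hin
  · intro l h
    rw [e l h]
    rfl

/-! ### The case `n = 2` -/

/-- The only braid relation, between `a_1 = t` and `a_2 = p0 * t`, already holds in the semidirect
product of the free group on `p0, p1` with the automorphism `p0 ↦ p1`, `p1 ↦ p0⁻¹ * p1`, so `p0` and
`p1` satisfy no relation. -/
theorem exists_freeGroupBasis_A2 : ∃ β : FreeGroupBasis (Fin 2) (commutator (ArtinA 2)),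
    (β 0 : ArtinA 2) = ArtinA.p0 le_rfl ∧ (β 1 : ArtinA 2) = ArtinA.p1 le_rfl := by
  let x0 : FreeGroup (Fin 2) := FreeGroup.of 0
  let x1 : FreeGroup (Fin 2) := FreeGroup.of 1
  let Φ : MulAut (FreeGroup (Fin 2)) := MonoidHom.toMulEquiv
    (FreeGroup.lift ![x1, x0⁻¹ * x1]) (FreeGroup.lift ![x0 * x1⁻¹, x0])
    (by ext i; fin_cases i <;> simp [x0, x1]) (by ext i; fin_cases i <;> simp [x0, x1])
  have Φ0 : Φ x0 = x1 :=
    FreeGroup.lift_apply_of (f := ![x1, x0⁻¹ * x1]) (x := 0)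
  have Φ1 : Φ x1 = x0⁻¹ * x1 :=
    FreeGroup.lift_apply_of (f := ![x1, x0⁻¹ * x1]) (x := 1)
  let f : FreeGroup (Fin 2) →* ArtinA 2 :=
    FreeGroup.lift ![ArtinA.p0 le_rfl, ArtinA.p1 le_rfl]
  have f0 : f x0 = ArtinA.p0 le_rfl := FreeGroup.lift_apply_of
  have f1 : f x1 = ArtinA.p1 le_rfl := FreeGroup.lift_apply_of
  have hf : f.comp Φ.toMonoidHom =
      (MulAut.conj (ArtinA.a 1 (by omega))).toMonoidHom.comp f := by
    have c0 := ArtinA.conj_p0 (n := 2) le_rfl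
    have c1 := ArtinA.conj_p1 (n := 2) le_rfl
    ext i
    fin_cases i
    · change f (Φ x0) = MulAut.conj _ (f x0)
      rw [Φ0, f0, f1, MulAut.conj_apply, c0]
    · change f (Φ x1) = MulAut.conj _ (f x1)
      rw [Φ1, map_mul, map_inv, f0, f1, MulAut.conj_apply, c1]
  obtain ⟨hinj, hrange⟩ := ArtinA.injective_and_range_eq_commutator (n := 2) le_rfl Φ f
    (fun i => if i = 1 then 1 else x0) (fun k => DFunLike.congr_fun hf k) rfl
    (by
      rintro i ⟨hi, hi'⟩
      obtain rfl | rfl : i = 1 ∨ i = 2 := by omega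
      · simp
      · simp [f0, ArtinA.p0])
    (by
      rw [eq_top_iff, ← FreeGroup.closure_range_of, Subgroup.closure_le]
      rintro _ ⟨i, rfl⟩
      refine Subgroup.subset_closure ?_
      fin_cases i
      · exact Or.inr ⟨2, by simp, rfl⟩
      · exact Or.inl Φ0.symm)
    (fun i j hi hij hj => by omega)
    (fun i hi hi' => by
      obtain rfl : i = 1 := by omega
      simp [Φ0, Φ1])
  let e : FreeGroup (Fin 2) ≃* commutator (ArtinA 2) :=
    (MonoidHom.ofInjective hinj).trans (MulEquiv.subgroupCongr hrange)
  exact ⟨⟨e.symm⟩, f0, f1⟩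

/-! ### Finite presentability -/

theorem HasPresentation.isFinitelyPresented {G ι : Type*} [Group G] [Finite ι] {H : Subgroup G}
    {f : ι → G} {R : FreeGroup ι → FreeGroup ι → Prop} (h : HasPresentation H f R)
    (hR : (relatorSet R).Finite) : Group.IsFinitelyPresented H := by
  obtain ⟨rfl, hker⟩ := h
  exact Group.IsFinitelyPresented.of_surjective (FreeGroup.lift f).rangeRestrict
    (FreeGroup.lift f).rangeRestrict_surjective
    ⟨relatorSet R, hR, by rw [MonoidHom.ker_rangeRestrict, hker]⟩

instance : Finite GenA3 :=
  Finite.of_injective (fun | .p0 => 0 | .p1 => 1 | .q => 2 | .b => 3 : GenA3 → Fin 4) (by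
    rintro (_ | _ | _ | _) (_ | _ | _ | _) h <;> first | rfl | exact absurd h (by decide))

instance {n : ℕ} : Finite (GenA n) := by
  refine Finite.of_surjective (α := Fin 3 ⊕ {l : Fin (n + 1) // 3 ≤ (l : ℕ)})
    (fun
      | .inl 0 => .p0
      | .inl 1 => .p1
      | .inl 2 => .b
      | .inr l => .q l.1 ⟨l.2, Nat.le_of_lt_succ l.1.2⟩) ?_
  rintro (_ | _ | _ | ⟨l, h⟩)
  exacts [⟨.inl 0, rfl⟩, ⟨.inl 1, rfl⟩, ⟨.inl 2, rfl⟩, ⟨.inr ⟨⟨l, by omega⟩, h.1⟩, rfl⟩]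

lemma GenA3.finite_relatorSet : (relatorSet GenA3.Rel).Finite := by
  refine (Set.toFinite {Bb * (P0 * Q * P0⁻¹)⁻¹, (P0 * Bb * P0⁻¹) * (Bb ^ 2 * Q⁻¹ * Bb)⁻¹,
    (P1 * Q * P1⁻¹) * (Q⁻¹ * Bb)⁻¹,
    (P1 * Bb * P1⁻¹) * ((Q⁻¹ * Bb) ^ 3 * (Q ^ 2)⁻¹ * Bb)⁻¹}).subset ?_
  rintro _ ⟨u, v, h, rfl⟩
  cases h <;> simp

lemma GenA.finite_relatorSet {n : ℕ} (hn : 4 ≤ n) : (relatorSet (GenA.Rel hn)).Finite := by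
  let q : ℕ → FreeGroup (GenA n) := fun l =>
    if h : 3 ≤ l ∧ l ≤ n then Q l h else 1
  have hq : ∀ l h, Q l h = q l := fun l h => (dif_pos h).symm
  -- a finite set that contains the relators, with `i` and `j` ranging over more pairs than needed
  have hfin : (⋃ i ∈ Set.Iic n, ⋃ j ∈ Set.Iic n, ({Bb * (P0 * q 3 * P0⁻¹)⁻¹,
      (P0 * Bb * P0⁻¹) * (Bb ^ 2 * (q 3)⁻¹ * Bb)⁻¹,
      (P1 * q 3 * P1⁻¹) * ((q 3)⁻¹ * Bb)⁻¹,
      (P1 * Bb * P1⁻¹) * (((q 3)⁻¹ * Bb) ^ 3 * (q 3 ^ 2)⁻¹ * Bb)⁻¹,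
      (P0 * q i) * (q i * P1)⁻¹, (P1 * q i) * (q i * P0⁻¹ * P1)⁻¹,
      (q i * q j) * (q j * q i)⁻¹,
      (q i * q j * q i) * (q j * q i * q j)⁻¹} : Set (FreeGroup (GenA n)))).Finite :=
    (Set.finite_Iic n).biUnion fun i _ => (Set.finite_Iic n).biUnion fun j _ => Set.toFinite _
  refine hfin.subset ?_
  rintro _ ⟨u, v, h, rfl⟩
  simp only [Set.mem_iUnion]
  cases h with
  | p0_q i hi => exact ⟨i, hi.2, i, hi.2, by simp [hq]⟩
  | p1_q i hi => exact ⟨i, hi.2, i, hi.2, by simp [hq]⟩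
  | q3_comm i hi => exact ⟨3, by simp; omega, i, hi.2, by simp [hq]⟩
  | q3_braid => exact ⟨3, by simp; omega, 4, hn, by simp [hq]⟩
  | q_comm i j hi hij hj => exact ⟨i, by simp; omega, j, hj, by simp [hq]⟩
  | q_braid i hi hin => exact ⟨i, by simp; omega, i + 1, hin, by simp [hq]⟩
  | _ => exact ⟨3, by simp; omega, 3, by simp; omega, by simp [hq]⟩

theorem mainTheorem6 :
    (∀ n : ℕ, 2 ≤ n → Group.IsFinitelyPresented (commutator (ArtinA n))) ∧
    (∃ β : FreeGroupBasis (Fin 2) (commutator (ArtinA 2)),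
      (β 0 : ArtinA 2) = ArtinA.p0 le_rfl ∧ (β 1 : ArtinA 2) = ArtinA.p1 le_rfl) ∧
    HasPresentation (commutator (ArtinA 3)) GenA3.val GenA3.Rel ∧
    (∀ (n : ℕ) (hn : 4 ≤ n),
      HasPresentation (commutator (ArtinA n)) (GenA.val hn) (GenA.Rel hn)) := by
  refine ⟨fun n hn => ?_, exists_freeGroupBasis_A2, hasPresentation_A3,
    fun n hn => hasPresentation_A hn⟩
  obtain rfl | rfl | hn4 : n = 2 ∨ n = 3 ∨ 4 ≤ n := by omega
  · obtain ⟨β, -⟩ := exists_freeGroupBasis_A2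
    exact Group.IsFinitelyPresented.equiv β.repr.symm
  · exact hasPresentation_A3.isFinitelyPresented GenA3.finite_relatorSet
  · exact (hasPresentation_A hn4).isFinitelyPresented (GenA.finite_relatorSet hn4)
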